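/- For integers $p\ge 0$, $k\in\{-1,0,\dots,p-1\}$ and $n\ge 1$, let $S_{p,k,n}\subset L^2(0,1)$ be the space of real-valued splines of degree $p$, smoothness $k$ and with $n$ uniform segments, that is, $$S_{p,k,n}=\Big\{f\in C^k([0,1]) : f|_{[\frac jn,\frac{j+1}n)} \text{ is a polynomial of degree at most } p \text{ for } j=0,\dots,n-1\Big\},$$ where $C^{-1}$ means that no smoothness is required, so that jumps are allowed at the breakpoints. Let $\Pi_{p,k,n}:L^2(0,1)\to S_{p,k,n}$ be the $L^2(0,1)$-orthogonal projection, let $\|\cdot\|$ be the norm of $L^2(0,1)$, and let $H^{p+1}(0,1)$ be the Sobolev space of real-valued functions in $L^2(0,1)$ whose weak derivatives of order up to $p+1$ lie in $L^2(0,1)$. **Theorem.** For all $p\ge 0$, $k\in\{-1,0,\dots,p-1\}$ and $n\ge 1$, there is a smallest real number $C_{p,k,n}$ such that $$\|f-\Pi_{p,k,n}f\|\le C_{p,k,n}\,\|\partial^{p+1}f\|\qquad\text{for all } f\in H^{p+1}(0,1),$$ and it satisfies $$\frac{(p+1)!}{(2p+2)!\,\sqrt{2p+3}}\;n^{-p-1}\;\le\;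 C_{p,k,n}\;\le\;(n\pi)^{-p-1}.$$ -/

import Mathlib

open MeasureTheory Set
open scoped ContDiff

noncomputable section

namespace SplineApprox

/-- Lebesgue measure on the open unit interval `(0,1)`. -/
abbrev unitMeasure : Measure ℝ := volume.restrict (Ioo (0 : ℝ) 1)

/-- The real Hilbert space `L²(0,1)`. -/
abbrev L2 : Type := Lp ℝ 2 unitMeasure

/-- `f` is a spline of degree `p`, smoothness `k` and with `n` uniform segments:
`f` is of class `C^k` on `[0,1]` (no condition if `k = -1`), and on every
`I_j = [j/n, (j+1)/n)`, `0 ≤ j < n`, it is a polynomial of degree at most `p`.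
The values of `f` outside `[0,1]` play no role. -/
def IsSpline (p : ℕ) (k : ℤ) (n : ℕ) (f : ℝ → ℝ) : Prop :=
  (∀ r : ℕ, (r : ℤ) ≤ k → ContDiffOn ℝ r f (Icc (0 : ℝ) 1)) ∧
  ∀ j : ℕ, j < n → ∃ q : Polynomial ℝ, q.natDegree ≤ p ∧
    ∀ x ∈ Ico ((j : ℝ) / n) (((j : ℝ) + 1) / n), f x = q.eval x

/-- The spline space as a linear subspace of `L²(0,1)`. -/
def splineSpace (p : ℕ) (k : ℤ) (n : ℕ) : Submodule ℝ L2 where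
  carrier := {u | ∃ f : ℝ → ℝ, IsSpline p k n f ∧ u =ᵐ[unitMeasure] f}
  zero_mem' := by
    refine ⟨0, ⟨fun r _ => contDiffOn_const, fun j _ => ⟨0, by simp, fun x _ => by simp⟩⟩, ?_⟩
    exact Lp.coeFn_zero _ _ _
  add_mem' := by
    rintro u v ⟨f, ⟨hf1, hf2⟩, huf⟩ ⟨g, ⟨hg1, hg2⟩, hvg⟩
    refine ⟨f + g, ⟨fun r hr => (hf1 r hr).add (hg1 r hr), fun j hj => ?_⟩, ?_⟩
    · obtain ⟨a, ha, ha'⟩ := hf2 j hj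
      obtain ⟨b, hb, hb'⟩ := hg2 j hj
      exact ⟨a + b, Polynomial.natDegree_add_le_of_degree_le ha hb,
        fun x hx => by simp [ha' x hx, hb' x hx]⟩
    · exact (Lp.coeFn_add u v).trans (huf.add hvg)
  smul_mem' := by
    rintro c u ⟨f, ⟨hf1, hf2⟩, huf⟩
    refine ⟨c • f, ⟨fun r hr => (hf1 r hr).const_smul c, fun j hj => ?_⟩, ?_⟩
    · obtain ⟨a, ha, ha'⟩ := hf2 j hj
      exact ⟨c • a, (Polynomial.natDegree_smul_le c a).trans ha,
        fun x hx => by simp [ha' x hx]⟩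
    · exact (Lp.coeFn_smul c u).trans (huf.const_smul c)

/-- The monomial `x^i` cut off to `[j/n, (j+1)/n)`. -/
def cutMonomial (n j i : ℕ) : ℝ → ℝ :=
  (Ico ((j : ℝ) / n) (((j : ℝ) + 1) / n)).indicator fun x => x ^ i

lemma memLp_cutMonomial (n j i : ℕ) : MemLp (cutMonomial n j i) 2 unitMeasure := by
  refine MemLp.of_bound (C := 1) ?_ ?_
  · exact ((measurable_id.pow_const i).indicator measurableSet_Ico).aestronglyMeasurable
  · refine (ae_restrict_mem measurableSet_Ioo).mono fun x hx => ?_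
    refine (norm_indicator_le_norm_self _ _).trans ?_
    rw [Real.norm_eq_abs, abs_of_nonneg (pow_nonneg hx.1.le i)]
    exact pow_le_one₀ hx.1.le hx.2.le

/-- Spline spaces are finite dimensional, so the `L²` projection onto them exists. -/
instance finiteDimensional_splineSpace (p : ℕ) (k : ℤ) (n : ℕ) [NeZero n] :
    FiniteDimensional ℝ (splineSpace p k n) := by
  classical
  let b : ℕ × ℕ → L2 := fun ji => (memLp_cutMonomial n ji.1 ji.2).toLp _
  let F : Finset (ℕ × ℕ) := Finset.range n ×ˢ Finset.range (p + 1)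
  have hfin : FiniteDimensional ℝ (Submodule.span ℝ (b '' (F : Set (ℕ × ℕ)))) :=
    FiniteDimensional.span_of_finite ℝ (F.finite_toSet.image b)
  refine Submodule.finiteDimensional_of_le (S₂ := Submodule.span ℝ (b '' (F : Set (ℕ × ℕ)))) ?_
  rintro u ⟨f, ⟨-, hf⟩, huf⟩
  choose! q hq hqf using hf
  have key : u = ∑ ji ∈ F, (q ji.1).coeff ji.2 • b ji := by
    refine Lp.ext ?_
    have h1 := Lp.coeFn_finsetSum F (fun ji => (q ji.1).coeff ji.2 • b ji)
    have h2 : ∀ᵐ x ∂unitMeasure, ∀ ji ∈ F,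
        ((q ji.1).coeff ji.2 • b ji : L2) x = (q ji.1).coeff ji.2 * cutMonomial n ji.1 ji.2 x := by
      rw [Filter.eventually_all_finset]
      intro ji _
      filter_upwards [Lp.coeFn_smul ((q ji.1).coeff ji.2) (b ji),
        (memLp_cutMonomial n ji.1 ji.2).coeFn_toLp] with x hx hx'
      rw [hx, Pi.smul_apply, hx', smul_eq_mul]
    filter_upwards [huf, h1, h2, ae_restrict_mem measurableSet_Ioo] with x hx h1 h2 hx01
    have hn : (0 : ℝ) < n := by exact_mod_cast Nat.pos_of_ne_zero (NeZero.ne n)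
    have hnx : 0 ≤ (n : ℝ) * x := mul_nonneg hn.le hx01.1.le
    set J := ⌊(n : ℝ) * x⌋₊ with hJ
    have hJn : J < n := by
      rw [hJ, Nat.floor_lt hnx]
      nlinarith [hx01.2]
    have hmem : ∀ j : ℕ, x ∈ Ico ((j : ℝ) / n) (((j : ℝ) + 1) / n) ↔ j = J := by
      intro j
      rw [mem_Ico, div_le_iff₀ hn, lt_div_iff₀ hn, mul_comm x, hJ, eq_comm,
        Nat.floor_eq_iff hnx]
    rw [hx, h1, Finset.sum_apply, Finset.sum_congr rfl h2, Finset.sum_product,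
      Finset.sum_eq_single J]
    · rw [hqf J hJn x ((hmem J).2 rfl),
        Polynomial.eval_eq_sum_range' (Nat.lt_succ_of_le (hq J hJn))]
      refine Finset.sum_congr rfl fun i _ => ?_
      simp only [cutMonomial]
      rw [indicator_of_mem ((hmem J).2 rfl)]
    · intro j _ hj
      refine Finset.sum_eq_zero fun i _ => ?_
      simp only [cutMonomial]
      rw [indicator_of_notMem (fun h => hj ((hmem j).1 h)), mul_zero]
    · intro h
      exact absurd (Finset.mem_range.2 hJn) h
  rw [key]
  exact Submodule.sum_mem _ fun ji hji =>
    Submodule.smul_mem _ _ (Submodule.subset_span ⟨ji, hji, rfl⟩)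

/-- The `L²` projection onto the spline space, as an operator on `L²(0,1)`. -/
def splineProj (p : ℕ) (k : ℤ) (n : ℕ) [NeZero n] : L2 →L[ℝ] L2 :=
  (splineSpace p k n).starProjection

/-- `g` is the weak (distributional) derivative of order `s` of `f` on `(0,1)`. -/
def HasWeakDeriv (s : ℕ) (f g : L2) : Prop :=
  ∀ φ : ℝ → ℝ, ContDiff ℝ ∞ φ → HasCompactSupport φ → tsupport φ ⊆ Ioo (0 : ℝ) 1 →
    ∫ x in Ioo (0 : ℝ) 1, f x * iteratedDeriv s φ x =
      (-1 : ℝ) ^ s * ∫ x in Ioo (0 : ℝ) 1, g x * φ x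

/-- `f` belongs to the Sobolev space `H^m(0,1)`: `f` is in `L²(0,1)` and has weak derivatives
of all orders up to `m` in `L²(0,1)`. -/
def MemSobolev (m : ℕ) (f : L2) : Prop :=
  ∀ s : ℕ, s ≤ m → ∃ g : L2, HasWeakDeriv s f g

/-- The real numbers `C` with `‖f - Π f‖ ≤ C ‖∂^{p+1} f‖` for all `f ∈ H^{p+1}(0,1)`, where `Π`
is the `L²` projection onto the spline space. -/
def admissibleConstants (p : ℕ) (k : ℤ) (n : ℕ) [NeZero n] : Set ℝ :=
  {C | ∀ f g : L2, MemSobolev (p + 1) f → HasWeakDeriv (p + 1) f g →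
    ‖f - splineProj p k n f‖ ≤ C * ‖g‖}

/-- The best constant `C_{p,k,n}`. -/
def bestConstant (p : ℕ) (k : ℤ) (n : ℕ) [NeZero n] : ℝ :=
  sInf (admissibleConstants p k n)

end SplineApprox

end

/-!
Write `h = 1 / n` for the length of a segment.

*Upper bound.* Splines of lower smoothness form a larger space, so only the space `S_q` of degree
`q` and maximal smoothness `q - 1` matters. Let `T u = ∫₀ˣ u - ½ ∫₀¹ u` (`skewVolterra`). This
operator is skew-adjoint on `L²(0,1)` and maps `S_q` into `S_{q+1}`. These two facts alone show that
a bound `‖T v‖ ≤ c ‖v‖` for `v ⊥ S_q` is inherited by `v ⊥ S_{q+1}`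
(`norm_le_of_mem_orthogonal_of_skewAdjoint`), so that such a bound is only needed for the piecewise
constants. A function orthogonal to those has a primitive that vanishes at all breakpoints, and
Wirtinger's inequality on each segment (`wirtinger_of_absolutelyContinuous`) gives
`c = h / π`. If `u` has the weak derivative `u'`, then `u - T u'` is constant by the lemma of
du Bois-Reymond, and duality again gives `dist (u, S_{q+1}) ≤ c · dist (u', S_q)`
(`norm_sub_starProjection_le_of_skewAdjoint`). Iterating from `f` down to `∂^{p+1} f` produces the
factor `c ^ (p + 1)`.

*Lower bound.* For `f = x ^ (p + 1)`, the difference of `f` and any spline is on each segment a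
monic polynomial of degree `p + 1`, whose `L²`-norm is at least that of the Legendre polynomial
(`le_integral_eval_sq_of_monic`), while `‖∂^{p+1} f‖ = (p + 1)!`.

The set of admissible constants is closed, nonempty by the upper bound and bounded below by the
lower bound, so its infimum is attained.
-/

namespace SplineApprox

/-! ### Monic polynomials of smallest `L²`-norm -/

open Polynomial in
lemma integral_eval_mul_iterate_derivative {a b : ℝ} (m : ℕ) (P W : ℝ[X])
    (ha : ∀ i < m, (derivative^[i] W).eval a = 0) (hb : ∀ i < m, (derivative^[i] W).eval b = 0) :
    ∫ x in a..b, P.eval x * (derivative^[m] W).eval x =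
      (-1) ^ m * ∫ x in a..b, (derivative^[m] P).eval x * W.eval x := by
  induction m generalizing P with
  | zero => simp
  | succ m ih =>
    have h := intervalIntegral.integral_mul_deriv_eq_deriv_mul (a := a) (b := b)
      (fun x _ => P.hasDerivAt x) (fun x _ => (derivative^[m] W).hasDerivAt x)
      (P.derivative.continuous.intervalIntegrable _ _)
      ((derivative (derivative^[m] W)).continuous.intervalIntegrable _ _)
    rw [ha m m.lt_succ_self, hb m m.lt_succ_self,
      ih P.derivative (fun i hi => ha i (by omega)) (fun i hi => hb i (by omega))] at h
    rw [Function.iterate_succ_apply' _ m W, h, Function.iterate_succ_apply]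
    ring

lemma integral_sub_pow_mul_sub_pow (a b : ℝ) (i j : ℕ) :
    ∫ x in a..b, (x - a) ^ i * (x - b) ^ j =
      (-1) ^ j * (i.factorial * j.factorial / (i + j + 1).factorial) * (b - a) ^ (i + j + 1) := by
  induction j generalizing i with
  | zero =>
    have := Nat.factorial_ne_zero i
    simp [intervalIntegral.integral_comp_sub_right (fun x => x ^ i) a, Nat.factorial_succ]
    field_simp
  | succ j ih =>
    have h := intervalIntegral.integral_mul_deriv_eq_deriv_mul (a := a) (b := b)
      (u := fun x => (x - b) ^ (j + 1)) (u' := fun x => (j + 1 : ℕ) * (x - b) ^ j * 1)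
      (v := fun x => (x - a) ^ (i + 1)) (v' := fun x => (i + 1 : ℕ) * (x - a) ^ i * 1)
      (fun x _ => ((hasDerivAt_id x).sub_const b).pow (j + 1))
      (fun x _ => ((hasDerivAt_id x).sub_const a).pow (i + 1))
      (Continuous.intervalIntegrable (by fun_prop) _ _)
      (Continuous.intervalIntegrable (by fun_prop) _ _)
    have e1 : (fun x => (x - b) ^ (j + 1) * ((i + 1 : ℕ) * (x - a) ^ i * 1)) =
      fun x : ℝ => ((i + 1 : ℕ) : ℝ) * ((x - a) ^ i * (x - b) ^ (j + 1)) := by ext; ring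
    have e2 : (fun x => (j + 1 : ℕ) * (x - b) ^ j * 1 * (x - a) ^ (i + 1)) =
      fun x : ℝ => ((j + 1 : ℕ) : ℝ) * ((x - a) ^ (i + 1) * (x - b) ^ j) := by ext; ring
    rw [e1, e2, intervalIntegral.integral_const_mul, intervalIntegral.integral_const_mul, ih] at h
    have hi : ((i + 1 : ℕ) : ℝ) ≠ 0 := by positivity
    apply mul_left_cancel₀ hi
    rw [h, show i + 1 + j + 1 = i + (j + 1) + 1 by ring, Nat.factorial_succ i, Nat.factorial_succ j]
    push_cast
    simp
    ring

open Polynomial in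
lemma iterate_derivative_natDegree_eq_C {m : ℕ} {P : ℝ[X]} (hP : P.natDegree ≤ m) :
    derivative^[m] P = C (m.factorial * P.coeff m) := by
  ext i
  rw [coeff_iterate_derivative, coeff_C]
  split_ifs with hi
  · subst hi; simp [Nat.descFactorial_self]
  · rw [coeff_eq_zero_of_natDegree_lt (by omega)]; simp

open Polynomial in
/-- Among monic polynomials of degree `m`, the Legendre polynomial
`m! / (2m)! · ∂^m ((x - a)^m (x - b)^m)` has the smallest `L²(a,b)`-norm. -/
lemma le_integral_eval_sq_of_monic {a b : ℝ} (hab : a < b) {m : ℕ} {P : ℝ[X]}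
    (hP : P.natDegree ≤ m) (hPm : P.coeff m = 1) :
    ((m.factorial : ℝ) ^ 2 / (2 * m).factorial) ^ 2 / (2 * m + 1) * (b - a) ^ (2 * m + 1) ≤
      ∫ x in a..b, P.eval x ^ 2 := by
  set W : ℝ[X] := (X - C a) ^ m * (X - C b) ^ m with hW
  set L : ℝ[X] := derivative^[m] W with hL
  have hWa : ∀ i < m, (derivative^[i] W).eval a = 0 := fun i hi => by
    have h := pow_sub_dvd_iterate_derivative_of_pow_dvd i (Dvd.intro _ hW.symm)
    exact dvd_iff_isRoot.1 ((dvd_pow_self _ (by omega)).trans h)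
  have hWb : ∀ i < m, (derivative^[i] W).eval b = 0 := fun i hi => by
    have h := pow_sub_dvd_iterate_derivative_of_pow_dvd i (Dvd.intro_left _ hW.symm)
    exact dvd_iff_isRoot.1 ((dvd_pow_self _ (by omega)).trans h)
  have hWmonic : W.Monic := ((monic_X_sub_C a).pow m).mul ((monic_X_sub_C b).pow m)
  have hWdeg : W.natDegree = 2 * m := by
    rw [hW, ((monic_X_sub_C a).pow m).natDegree_mul ((monic_X_sub_C b).pow m)]
    simp; ring
  set B : ℝ := (m.factorial * m.factorial / (2 * m + 1).factorial) * (b - a) ^ (2 * m + 1) with hB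
  have hint : (-1) ^ m * ∫ x in a..b, W.eval x = B := by
    have := integral_sub_pow_mul_sub_pow a b m m
    rw [← two_mul] at this
    simp only [hW, eval_mul, eval_pow, eval_sub, eval_X, eval_C]
    rw [this, ← mul_assoc, ← mul_assoc, ← mul_pow]
    simp [hB]
  have key : ∀ Q : ℝ[X], Q.natDegree ≤ m →
      ∫ x in a..b, Q.eval x * L.eval x = m.factorial * Q.coeff m * B := fun Q hQ => by
    rw [hL, integral_eval_mul_iterate_derivative m Q W hWa hWb,
      iterate_derivative_natDegree_eq_C hQ]
    simp only [eval_C]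
    rw [intervalIntegral.integral_const_mul, ← hint]
    ring
  have hLdeg : L.natDegree ≤ m := by
    have := natDegree_iterate_derivative W m
    rw [hL]; omega
  have hLc : L.coeff m = (2 * m).factorial / m.factorial := by
    rw [hL, coeff_iterate_derivative, ← two_mul, ← hWdeg, hWmonic.coeff_natDegree, hWdeg]
    have := Nat.factorial_mul_descFactorial (show m ≤ 2 * m by omega)
    rw [show 2 * m - m = m by omega] at this
    rw [← this]
    have := Nat.factorial_ne_zero m
    push_cast; simp; field_simp
  have hPL := key P hP
  have hLL := key L hLdeg
  rw [hPm, mul_one] at hPL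
  -- `c * L` is the monic Legendre polynomial; expand `0 ≤ ‖P - c * L‖²`
  set c : ℝ := m.factorial / (2 * m).factorial with hc
  have f1 : (0 : ℝ) < m.factorial := by positivity
  have f2 : (0 : ℝ) < (2 * m).factorial := by positivity
  have hpos : 0 ≤ ∫ x in a..b, (P.eval x - c * L.eval x) ^ 2 :=
    intervalIntegral.integral_nonneg hab.le fun x _ => sq_nonneg _
  have hexp : ∫ x in a..b, (P.eval x - c * L.eval x) ^ 2 =
      (∫ x in a..b, P.eval x ^ 2) - 2 * c * (∫ x in a..b, P.eval x * L.eval x)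
        + c ^ 2 * ∫ x in a..b, L.eval x * L.eval x := by
    rw [← intervalIntegral.integral_const_mul, ← intervalIntegral.integral_const_mul,
      ← intervalIntegral.integral_sub, ← intervalIntegral.integral_add]
    · congr 1; ext x; ring
    all_goals exact Continuous.intervalIntegrable (by fun_prop) _ _
  rw [hexp, hPL, hLL, hLc] at hpos
  refine le_trans (le_of_eq ?_) (sub_nonneg.1 (hpos.trans (le_of_eq (?_ :
    _ = (∫ x in a..b, P.eval x ^ 2) - c * m.factorial * B))))
  · rw [hc, hB, Nat.factorial_succ]
    push_cast
    field_simp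
  · rw [hc]; field_simp; ring

/-! ### Wirtinger's inequality -/

open Real in
/-- Wirtinger's inequality with the sharp constant, for functions that vanish at both end points.
For `r < π / (b - a)` the function `w x = -r tan (r (x - (a + b) / 2))` is smooth on `[a, b]` and
satisfies the Riccati equation `w' = -r² - w²`, so `(u' - w u)² = u'² - r² u² - (w u²)'`. -/
theorem wirtinger_of_absolutelyContinuous {u : ℝ → ℝ} {a b : ℝ} (hab : a < b)
    (hu : AbsolutelyContinuousOnInterval u a b) (ha : u a = 0) (hb : u b = 0)
    (hint : IntervalIntegrable (fun x => deriv u x ^ 2) volume a b) :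
    (π / (b - a)) ^ 2 * ∫ x in a..b, u x ^ 2 ≤ ∫ x in a..b, deriv u x ^ 2 := by
  have hba : 0 < b - a := sub_pos.2 hab
  have hucont : ContinuousOn u (uIcc a b) := hu.continuousOn
  have hu2 : IntervalIntegrable (fun x => u x ^ 2) volume a b :=
    (hucont.pow 2).intervalIntegrable
  have key : ∀ r ∈ Ioo 0 (π / (b - a)),
      r ^ 2 * ∫ x in a..b, u x ^ 2 ≤ ∫ x in a..b, deriv u x ^ 2 := by
    rintro r ⟨hr0, hr⟩
    rw [lt_div_iff₀ hba] at hr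
    set w : ℝ → ℝ := fun x => -r * tan (r * (x - (a + b) / 2)) with hw
    have hcos : ∀ x ∈ Icc a b, cos (r * (x - (a + b) / 2)) ≠ 0 := fun x hx =>
      (cos_pos_of_mem_Ioo ⟨by nlinarith [hx.1], by nlinarith [hx.2]⟩).ne'
    have hwd : ∀ x ∈ Icc a b, HasDerivAt w (-r ^ 2 - w x ^ 2) x := fun x hx => by
      have h1 : HasDerivAt (fun x => r * (x - (a + b) / 2)) (r * 1) x :=
        ((hasDerivAt_id x).sub_const _).const_mul r
      refine (((hasDerivAt_tan (hcos x hx)).comp x h1).const_mul (-r)).congr_deriv ?_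
      simp only [hw]
      rw [← inv_one_add_tan_sq (hcos x hx)]
      simp
      ring
    have hwac : AbsolutelyContinuousOnInterval w a b := by
      refine ContDiffOn.absolutelyContinuousOnInterval ?_
      rw [uIcc_of_le hab.le]
      intro x hx
      refine ContDiffAt.contDiffWithinAt ?_
      have h2 : ContDiffAt ℝ 1 (fun x => r * (x - (a + b) / 2)) x := by fun_prop
      exact contDiffAt_const.mul
        (ContDiffAt.comp (g := tan) x (contDiffAt_tan.2 (hcos x hx)) h2)
    have hprod : AbsolutelyContinuousOnInterval (fun x => w x * (u x * u x)) a b :=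
      hwac.mul (hu.mul hu)
    have hzero := hprod.integral_deriv_eq_sub
    simp only [ha, hb, mul_zero, sub_zero] at hzero
    have hle : ∫ x in a..b, deriv (fun x => w x * (u x * u x)) x ≤
        ∫ x in a..b, (deriv u x ^ 2 - r ^ 2 * u x ^ 2) := by
      refine intervalIntegral.integral_mono_ae_restrict hab.le hprod.intervalIntegrable_deriv
        (hint.sub (hu2.const_mul _)) ?_
      rw [Filter.EventuallyLE, ae_restrict_iff' measurableSet_Icc]
      filter_upwards [hu.ae_differentiableAt] with x hx hxI
      have hux := (hx (by rwa [uIcc_of_le hab.le])).hasDerivAt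
      have hd : HasDerivAt (fun x => w x * (u x * u x)) _ x := (hwd x hxI).mul (hux.mul hux)
      rw [hd.deriv]
      nlinarith [sq_nonneg (deriv u x - w x * u x)]
    rw [hzero, intervalIntegral.integral_sub hint (hu2.const_mul _),
      intervalIntegral.integral_const_mul] at hle
    linarith
  have hlim : Filter.Tendsto (fun r : ℝ => r ^ 2 * ∫ x in a..b, u x ^ 2)
      (nhdsWithin (π / (b - a)) (Iio (π / (b - a))))
      (nhds ((π / (b - a)) ^ 2 * ∫ x in a..b, u x ^ 2)) :=
    (Continuous.tendsto (by fun_prop) _).mono_left nhdsWithin_le_nhds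
  refine le_of_tendsto hlim ?_
  filter_upwards [Ioo_mem_nhdsLT (show 0 < π / (b - a) by positivity)] with r hr using key r hr

/-! ### The Volterra operator on `L²(0,1)` -/

instance : IsProbabilityMeasure unitMeasure := ⟨by simp⟩

lemma integral_unitMeasure (h : ℝ → ℝ) : ∫ x, h x ∂unitMeasure = ∫ x in (0 : ℝ)..1, h x := by
  rw [intervalIntegral.integral_of_le zero_le_one, integral_Ioc_eq_integral_Ioo]

lemma inner_eq_intervalIntegral (u v : L2) : inner ℝ u v = ∫ x in (0 : ℝ)..1, u x * v x := by
  rw [L2.inner_def, ← integral_unitMeasure]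
  exact integral_congr_ae (.of_forall fun x => by simp [mul_comm])

lemma norm_sq_eq_intervalIntegral (u : L2) : ‖u‖ ^ 2 = ∫ x in (0 : ℝ)..1, u x ^ 2 := by
  rw [← real_inner_self_eq_norm_sq, inner_eq_intervalIntegral]
  simp only [sq]

lemma intervalIntegral_congr_unitMeasure {f g : ℝ → ℝ} (h : f =ᵐ[unitMeasure] g) :
    ∫ x in (0 : ℝ)..1, f x = ∫ x in (0 : ℝ)..1, g x := by
  rw [← integral_unitMeasure, ← integral_unitMeasure, integral_congr_ae h]

lemma intervalIntegrable_coeFn (u : L2) : IntervalIntegrable u volume 0 1 := by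
  rw [intervalIntegrable_iff_integrableOn_Ioo_of_le zero_le_one]
  exact (Lp.memLp u).integrable one_le_two

lemma intervalIntegrable_coeFn_sq (u : L2) :
    IntervalIntegrable (fun x => u x ^ 2) volume 0 1 := by
  rw [intervalIntegrable_iff_integrableOn_Ioo_of_le zero_le_one]
  exact (Lp.memLp u).integrable_sq

/-- The primitive of `u ∈ L²(0,1)` that vanishes at `0`. -/
noncomputable def primitive (u : L2) (x : ℝ) : ℝ := ∫ t in (0 : ℝ)..x, u t

@[simp] lemma primitive_zero_right (u : L2) : primitive u 0 = 0 := by simp [primitive]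

lemma absolutelyContinuousOnInterval_primitive (u : L2) :
    AbsolutelyContinuousOnInterval (primitive u) 0 1 :=
  (intervalIntegrable_coeFn u).absolutelyContinuousOnInterval_intervalIntegral left_mem_uIcc

lemma continuousOn_primitive (u : L2) : ContinuousOn (primitive u) (Icc 0 1) := by
  simpa [uIcc_of_le] using (absolutelyContinuousOnInterval_primitive u).continuousOn

lemma ae_deriv_primitive (u : L2) :
    ∀ᵐ x, x ∈ Icc (0 : ℝ) 1 → deriv (primitive u) x = u x := by
  filter_upwards [(intervalIntegrable_coeFn u).ae_hasDerivAt_integral] with x hx hxI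
  rw [uIcc_of_le zero_le_one] at hx
  exact (hx hxI 0 (by simp)).deriv

lemma abs_primitive_le (u : L2) {x : ℝ} (hx : x ∈ Icc (0 : ℝ) 1) : |primitive u x| ≤ ‖u‖ := by
  have h1 : |primitive u x| ≤ ∫ t in (0 : ℝ)..1, |u t| := by
    refine (intervalIntegral.abs_integral_le_integral_abs hx.1).trans ?_
    refine intervalIntegral.integral_mono_interval le_rfl hx.1 hx.2
      (.of_forall fun t => abs_nonneg _) (intervalIntegrable_coeFn u).abs
  refine h1.trans ?_
  rw [← integral_unitMeasure, Lp.norm_def]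
  have h2 : ∫ t, |u t| ∂unitMeasure = (eLpNorm u 1 unitMeasure).toReal := by
    rw [eLpNorm_one_eq_lintegral_enorm, ← integral_norm_eq_lintegral_enorm
      (Lp.aestronglyMeasurable u)]
    simp
  rw [h2]
  exact ENNReal.toReal_mono (Lp.eLpNorm_ne_top u)
    (eLpNorm_le_eLpNorm_of_exponent_le one_le_two (Lp.aestronglyMeasurable u))

lemma memLp_primitive (u : L2) : MemLp (primitive u) 2 unitMeasure := by
  refine MemLp.of_bound (C := ‖u‖) ?_ ?_
  · exact ((continuousOn_primitive u).mono Ioo_subset_Icc_self).aestronglyMeasurable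
      measurableSet_Ioo
  · exact (ae_restrict_mem measurableSet_Ioo).mono fun x hx =>
      abs_primitive_le u (Ioo_subset_Icc_self hx)

/-- The Volterra operator `u ↦ (x ↦ ∫₀ˣ u)` on `L²(0,1)`. -/
noncomputable def volterra : L2 →L[ℝ] L2 :=
  LinearMap.mkContinuous
    { toFun := fun u => (memLp_primitive u).toLp _
      map_add' := fun u v => by
        rw [← MemLp.toLp_add, MemLp.toLp_eq_toLp_iff]
        filter_upwards [ae_restrict_mem measurableSet_Ioo] with x hx
        have hsub : uIcc 0 x ⊆ uIcc (0 : ℝ) 1 :=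
          uIcc_subset_uIcc_left (by rw [uIcc_of_le zero_le_one]; exact Ioo_subset_Icc_self hx)
        simp only [primitive, Pi.add_apply]
        rw [← intervalIntegral.integral_add ((intervalIntegrable_coeFn u).mono_set hsub)
          ((intervalIntegrable_coeFn v).mono_set hsub)]
        refine intervalIntegral.integral_congr_ae_restrict ?_
        have := ae_restrict_of_ae_restrict_of_subset (μ := volume) (s := Ioo 0 x)
          (Ioo_subset_Ioo_right hx.2.le) (Lp.coeFn_add u v)
        rw [uIoc_of_le hx.1.le]
        rwa [Measure.restrict_congr_set Ioo_ae_eq_Ioc] at this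
      map_smul' := fun c u => by
        rw [RingHom.id_apply, ← MemLp.toLp_const_smul, MemLp.toLp_eq_toLp_iff]
        filter_upwards [ae_restrict_mem measurableSet_Ioo] with x hx
        simp only [primitive, Pi.smul_apply, smul_eq_mul]
        rw [← intervalIntegral.integral_const_mul]
        refine intervalIntegral.integral_congr_ae_restrict ?_
        have := ae_restrict_of_ae_restrict_of_subset (μ := volume) (s := Ioo 0 x)
          (Ioo_subset_Ioo_right hx.2.le) (Lp.coeFn_smul c u)
        rw [uIoc_of_le hx.1.le]
        rwa [Measure.restrict_congr_set Ioo_ae_eq_Ioc] at this } 1 fun u => by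
    refine (Lp.norm_le_of_ae_bound (norm_nonneg u) ?_).trans (by simp [measureUnivNNReal])
    filter_upwards [(memLp_primitive u).coeFn_toLp, ae_restrict_mem measurableSet_Ioo] with x hx hxI
    simp only [LinearMap.coe_mk, AddHom.coe_mk]
    rw [hx]
    exact abs_primitive_le u (Ioo_subset_Icc_self hxI)

lemma coeFn_volterra (u : L2) : volterra u =ᵐ[unitMeasure] primitive u :=
  (memLp_primitive u).coeFn_toLp

/-- The constant function `1` as an element of `L²(0,1)`. -/
noncomputable def oneL2 : L2 := (memLp_const (1 : ℝ)).toLp fun _ => 1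

lemma coeFn_oneL2 : oneL2 =ᵐ[unitMeasure] fun _ => 1 := (memLp_const (1 : ℝ)).coeFn_toLp

lemma inner_oneL2 (u : L2) : inner ℝ oneL2 u = primitive u 1 := by
  rw [inner_eq_intervalIntegral, primitive]
  refine intervalIntegral_congr_unitMeasure ?_
  filter_upwards [coeFn_oneL2] with x hx
  rw [hx, one_mul]

/-- Integration by parts. -/
lemma inner_volterra_add (u v : L2) :
    inner ℝ (volterra u) v + inner ℝ u (volterra v) = primitive u 1 * primitive v 1 := by
  have h := (absolutelyContinuousOnInterval_primitive u).integral_deriv_mul_eq_sub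
    (absolutelyContinuousOnInterval_primitive v)
  have hu := (continuousOn_primitive u)
  have hv := (continuousOn_primitive v)
  rw [← uIcc_of_le zero_le_one] at hu hv
  simp only [primitive_zero_right, mul_zero, sub_zero] at h
  have e1 : inner ℝ (volterra u) v = ∫ x in (0 : ℝ)..1, primitive u x * v x := by
    rw [inner_eq_intervalIntegral]
    refine intervalIntegral_congr_unitMeasure ?_
    filter_upwards [coeFn_volterra u] with x hx
    rw [hx]
  have e2 : inner ℝ u (volterra v) = ∫ x in (0 : ℝ)..1, u x * primitive v x := by
    rw [inner_eq_intervalIntegral]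
    refine intervalIntegral_congr_unitMeasure ?_
    filter_upwards [coeFn_volterra v] with x hx
    rw [hx]
  rw [e1, e2, ← intervalIntegral.integral_add ((intervalIntegrable_coeFn v).continuousOn_mul hu)
    ((intervalIntegrable_coeFn u).mul_continuousOn hv), ← h]
  refine intervalIntegral.integral_congr_ae ?_
  filter_upwards [ae_deriv_primitive u, ae_deriv_primitive v] with x hxu hxv hx
  rw [uIoc_of_le zero_le_one] at hx
  rw [hxu (Ioc_subset_Icc_self hx), hxv (Ioc_subset_Icc_self hx)]
  ring

/-- The Volterra operator corrected by a constant: `u ↦ (x ↦ ∫₀ˣ u - ½ ∫₀¹ u)`. -/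
noncomputable def skewVolterra : L2 →L[ℝ] L2 :=
  volterra - (1 / 2 : ℝ) • (innerSL ℝ oneL2).smulRight oneL2

lemma skewVolterra_apply (u : L2) :
    skewVolterra u = volterra u - (1 / 2 * primitive u 1) • oneL2 := by
  simp [skewVolterra, inner_oneL2, smul_smul]

/-- `u ↦ (x ↦ ∫₀ˣ u - ½ ∫₀¹ u)` is skew-adjoint: its values have the boundary values
`∓ ½ ∫₀¹ u` at `0` and `1`, so the boundary terms of an integration by parts cancel. -/
lemma inner_skewVolterra (u v : L2) :
    inner ℝ (skewVolterra u) v = -inner ℝ u (skewVolterra v) := by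
  have h := inner_volterra_add u v
  rw [skewVolterra_apply, skewVolterra_apply, inner_sub_left, inner_sub_right, inner_smul_left,
    inner_smul_right, inner_oneL2, real_inner_comm oneL2 u, inner_oneL2, conj_trivial]
  linarith

/-! ### Skew-adjoint operators and orthogonal complements -/

section Abstract

variable {E : Type*} [NormedAddCommGroup E] [InnerProductSpace ℝ E]

/-- If `T` is skew-adjoint and maps `S` into `S'`, then a bound for `T` on `Sᗮ` is inherited by
`S'ᗮ`: for `v ∈ S'ᗮ` and `w` the component of `T v` in `Sᗮ`, one has
`‖T v‖² = -⟪v, T (T v)⟫ = -⟪v, T w⟫ ≤ c ‖v‖ ‖T v‖`. -/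
lemma norm_le_of_mem_orthogonal_of_skewAdjoint {T : E →L[ℝ] E}
    (hT : ∀ u v, inner ℝ (T u) v = -inner ℝ u (T v)) {S S' : Submodule ℝ E}
    [S.HasOrthogonalProjection] (hS : ∀ u ∈ S, T u ∈ S') {c : ℝ} (hc0 : 0 ≤ c)
    (hc : ∀ v ∈ Sᗮ, ‖T v‖ ≤ c * ‖v‖) {v : E} (hv : v ∈ S'ᗮ) : ‖T v‖ ≤ c * ‖v‖ := by
  set w := T v - S.starProjection (T v) with hw
  have hwS : w ∈ Sᗮ := S.sub_starProjection_mem_orthogonal (T v)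
  have h0 : inner ℝ v (T (S.starProjection (T v))) = 0 :=
    Submodule.inner_left_of_mem_orthogonal (hS _ (S.starProjection_apply_mem _)) hv
  have h1 : ‖T v‖ ^ 2 = -inner ℝ v (T w) := by
    rw [← real_inner_self_eq_norm_sq, hT, hw, map_sub, inner_sub_right, h0, sub_zero]
  have h2 : ‖w‖ ≤ ‖T v‖ := by
    rw [hw, ← S.starProjection_orthogonal_val]
    exact Sᗮ.norm_starProjection_apply_le _
  have h3 : -inner ℝ v (T w) ≤ ‖v‖ * ‖T w‖ := by
    rw [← inner_neg_left]
    simpa using real_inner_le_norm (-v) (T w)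
  have h4 : ‖T w‖ ≤ c * ‖T v‖ := (hc w hwS).trans (by gcongr)
  have h5 : ‖T v‖ * ‖T v‖ ≤ c * ‖v‖ * ‖T v‖ := by
    nlinarith [mul_le_mul_of_nonneg_left h4 (norm_nonneg v)]
  rcases (norm_nonneg (T v)).eq_or_lt with h | h
  · rw [← h]; positivity
  · exact le_of_mul_le_mul_right h5 h

/-- If `f` and `T g` differ by an element of `S'`, then the distance of `f` to `S'` is bounded
by `c` times the distance of `g` to any `S` that `T` maps into `S'`, where `c` bounds the
skew-adjoint operator `T` on `S'ᗮ`. -/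
lemma norm_sub_starProjection_le_of_skewAdjoint {T : E →L[ℝ] E}
    (hT : ∀ u v, inner ℝ (T u) v = -inner ℝ u (T v)) {S S' : Submodule ℝ E}
    [S.HasOrthogonalProjection] [S'.HasOrthogonalProjection] (hS : ∀ u ∈ S, T u ∈ S') {c : ℝ}
    (hc0 : 0 ≤ c) (hc : ∀ v ∈ S'ᗮ, ‖T v‖ ≤ c * ‖v‖) {f g : E} (hfg : f - T g ∈ S') :
    ‖f - S'.starProjection f‖ ≤ c * ‖g - S.starProjection g‖ := by
  set v := f - S'.starProjection f with hv
  set w := g - S.starProjection g with hw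
  have hvS : v ∈ S'ᗮ := S'.sub_starProjection_mem_orthogonal f
  -- `v - T w` lies in `S'`, hence is orthogonal to `v`
  have hmem : v - T w ∈ S' := by
    have : v - T w = (f - T g) - S'.starProjection f + T (S.starProjection g) := by
      rw [hv, hw, map_sub]; abel
    rw [this]
    exact S'.add_mem (S'.sub_mem hfg (S'.starProjection_apply_mem _))
      (hS _ (S.starProjection_apply_mem _))
  have h1 : ‖v‖ ^ 2 = -inner ℝ (T v) w := by
    have := Submodule.inner_left_of_mem_orthogonal hmem hvS
    rw [inner_sub_right, sub_eq_zero, real_inner_self_eq_norm_sq] at this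
    rw [this, hT, neg_neg]
  have h3 : -inner ℝ (T v) w ≤ ‖T v‖ * ‖w‖ := by
    rw [← inner_neg_left]
    simpa using real_inner_le_norm (-T v) w
  have h5 : ‖v‖ * ‖v‖ ≤ c * ‖w‖ * ‖v‖ := by
    nlinarith [mul_le_mul_of_nonneg_right (hc v hvS) (norm_nonneg w)]
  rcases (norm_nonneg v).eq_or_lt with h | h
  · rw [← h]; positivity
  · exact le_of_mul_le_mul_right h5 h

end Abstract

/-! ### Spline spaces and the Volterra operator -/

lemma IsSpline.mono_smoothness {p : ℕ} {k l : ℤ} (hkl : k ≤ l) {n : ℕ} {f : ℝ → ℝ}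
    (hf : IsSpline p l n f) : IsSpline p k n f :=
  ⟨fun r hr => hf.1 r (hr.trans hkl), hf.2⟩

lemma splineSpace_mono_smoothness {p : ℕ} {k l : ℤ} (hkl : k ≤ l) (n : ℕ) :
    splineSpace p l n ≤ splineSpace p k n :=
  fun _ ⟨f, hf, huf⟩ => ⟨f, hf.mono_smoothness hkl, huf⟩

lemma smul_oneL2_mem_splineSpace (c : ℝ) (p : ℕ) (k : ℤ) (n : ℕ) :
    c • oneL2 ∈ splineSpace p k n := by
  refine Submodule.smul_mem _ _ ⟨fun _ => 1, ⟨fun r _ => contDiffOn_const, fun j _ => ⟨1, ?_⟩⟩,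
    coeFn_oneL2⟩
  simp

lemma toLp_cutMonomial_zero_mem_splineSpace (n j : ℕ) :
    (memLp_cutMonomial n j 0).toLp _ ∈ splineSpace 0 (-1) n := by
  refine ⟨cutMonomial n j 0, ⟨fun r hr => by omega, fun i hi => ?_⟩, MemLp.coeFn_toLp _⟩
  have hn : (0 : ℝ) < n := by exact_mod_cast (Nat.zero_le i).trans_lt hi
  rcases eq_or_ne i j with rfl | hij
  · exact ⟨1, by simp, fun x hx => by simp [cutMonomial, indicator_of_mem hx]⟩
  · refine ⟨0, by simp, fun x hx => ?_⟩
    rw [cutMonomial, indicator_of_notMem, Polynomial.eval_zero]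
    rintro ⟨h1, h2⟩
    obtain ⟨h3, h4⟩ := hx
    rw [div_le_iff₀ hn] at h1 h3
    rw [lt_div_iff₀ hn] at h2 h4
    have h5 : i < j + 1 := by exact_mod_cast h3.trans_lt h2
    have h6 : j < i + 1 := by exact_mod_cast h1.trans_lt h4
    omega

section Segments

variable {n : ℕ}

lemma segment_lt [NeZero n] (j : ℕ) : (j : ℝ) / n < ((j : ℝ) + 1) / n := by
  have hn : (0 : ℝ) < n := by exact_mod_cast Nat.pos_of_ne_zero (NeZero.ne n)
  gcongr
  linarith

lemma segment_subset [NeZero n] {j : ℕ} (hj : j < n) :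
    Icc ((j : ℝ) / n) (((j : ℝ) + 1) / n) ⊆ Icc 0 1 := by
  have hn : (0 : ℝ) < n := by exact_mod_cast Nat.pos_of_ne_zero (NeZero.ne n)
  refine Icc_subset_Icc (by positivity) ?_
  rw [div_le_one hn]
  exact_mod_cast hj

lemma uIcc_segment_subset [NeZero n] {j : ℕ} (hj : j < n) :
    uIcc ((j : ℝ) / n) (((j : ℝ) + 1) / n) ⊆ uIcc 0 1 := by
  rw [uIcc_of_le (segment_lt j).le, uIcc_of_le zero_le_one]
  exact segment_subset hj

lemma sum_integral_segments [NeZero n] {h : ℝ → ℝ} (hh : IntervalIntegrable h volume 0 1) :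
    ∑ j ∈ Finset.range n, ∫ x in ((j : ℝ) / n)..(((j : ℝ) + 1) / n), h x =
      ∫ x in (0 : ℝ)..1, h x := by
  have := intervalIntegral.sum_integral_adjacent_intervals (f := h) (μ := volume)
    (a := fun j : ℕ => (j : ℝ) / n) (n := n) fun j hj => by
      simpa using hh.mono_set (uIcc_segment_subset hj)
  simpa [NeZero.ne n] using this

/-- Testing against the cut-off monomials of exponent `0`, the indicators of the segments. -/
lemma integral_segment_eq_zero [NeZero n] {v : L2} (hv : v ∈ (splineSpace 0 (-1) n)ᗮ) {j : ℕ}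
    (hj : j < n) : ∫ x in ((j : ℝ) / n)..(((j : ℝ) + 1) / n), v x = 0 := by
  have h := hv _ (toLp_cutMonomial_zero_mem_splineSpace n j)
  rw [inner_eq_intervalIntegral] at h
  have hI := segment_subset hj
  rw [Icc_subset_Icc_iff (segment_lt j).le] at hI
  rw [intervalIntegral_congr_unitMeasure (g := (Ico ((j : ℝ) / n) (((j : ℝ) + 1) / n)).indicator v),
    intervalIntegral.integral_of_le zero_le_one, ← integral_Ico_eq_integral_Ioc,
    setIntegral_indicator measurableSet_Ico, inter_eq_right.2 (Ico_subset_Ico hI.1 hI.2),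
    integral_Ico_eq_integral_Ioc, ← intervalIntegral.integral_of_le (segment_lt j).le] at h
  · exact h
  · filter_upwards [(memLp_cutMonomial n j 0).coeFn_toLp] with x hx
    rw [hx, cutMonomial]
    by_cases hxI : x ∈ Ico ((j : ℝ) / n) (((j : ℝ) + 1) / n) <;> simp [hxI]

lemma primitive_sub_primitive (u : L2) {a b : ℝ} (ha : a ∈ Icc (0 : ℝ) 1)
    (hb : b ∈ Icc (0 : ℝ) 1) : primitive u b - primitive u a = ∫ x in a..b, u x := by
  refine intervalIntegral.integral_interval_sub_left ?_ ?_ <;>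
  refine (intervalIntegrable_coeFn u).mono_set (uIcc_subset_uIcc_left ?_) <;>
  rwa [uIcc_of_le zero_le_one]

lemma primitive_breakpoint_eq_zero [NeZero n] {v : L2} (hv : v ∈ (splineSpace 0 (-1) n)ᗮ) (j : ℕ)
    (hj : j ≤ n) : primitive v ((j : ℝ) / n) = 0 := by
  induction j with
  | zero => simp
  | succ j ih =>
    have h := primitive_sub_primitive v
      (segment_subset hj (left_mem_Icc.2 (segment_lt j).le))
      (segment_subset hj (right_mem_Icc.2 (segment_lt j).le))
    rw [integral_segment_eq_zero hv hj, ih (by omega)] at h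
    push_cast
    linarith

open Real in
/-- A function orthogonal to the piecewise constants has a primitive that vanishes at all
breakpoints, so Wirtinger's inequality applies on every segment. -/
lemma norm_skewVolterra_le_of_mem_orthogonal_piecewiseConstant [NeZero n] {v : L2}
    (hv : v ∈ (splineSpace 0 (-1) n)ᗮ) : ‖skewVolterra v‖ ≤ (n * π)⁻¹ * ‖v‖ := by
  have hn : (0 : ℝ) < n := by exact_mod_cast Nat.pos_of_ne_zero (NeZero.ne n)
  have h1 : primitive v 1 = 0 := by
    simpa [hn.ne'] using primitive_breakpoint_eq_zero hv n le_rfl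
  have hT : skewVolterra v = volterra v := by simp [skewVolterra_apply, h1]
  have hcont : ContinuousOn (primitive v) (uIcc 0 1) := by
    rw [uIcc_of_le zero_le_one]; exact continuousOn_primitive v
  have hprim : ‖volterra v‖ ^ 2 = ∫ x in (0 : ℝ)..1, primitive v x ^ 2 := by
    rw [norm_sq_eq_intervalIntegral]
    refine intervalIntegral_congr_unitMeasure ?_
    filter_upwards [coeFn_volterra v] with x hx
    rw [hx]
  have hsq : ‖volterra v‖ ^ 2 * (n * π) ^ 2 ≤ ‖v‖ ^ 2 := by
    rw [hprim, norm_sq_eq_intervalIntegral v,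
      ← sum_integral_segments (n := n) (h := fun x => primitive v x ^ 2)
        (hcont.pow 2).intervalIntegrable,
      ← sum_integral_segments (n := n) (intervalIntegrable_coeFn_sq v), Finset.sum_mul]
    refine Finset.sum_le_sum fun j hj => ?_
    rw [Finset.mem_range] at hj
    have hae : ∀ᵐ x, x ∈ uIoc ((j : ℝ) / n) (((j : ℝ) + 1) / n) →
        deriv (primitive v) x ^ 2 = v x ^ 2 := by
      filter_upwards [ae_deriv_primitive v] with x hx hxI
      rw [uIoc_of_le (segment_lt j).le] at hxI
      rw [hx (segment_subset hj (Ioc_subset_Icc_self hxI))]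
    have hw := wirtinger_of_absolutelyContinuous (segment_lt (n := n) j)
      ((absolutelyContinuousOnInterval_primitive v).mono (uIcc_segment_subset hj))
      (primitive_breakpoint_eq_zero hv j hj.le)
      (by simpa using primitive_breakpoint_eq_zero hv (j + 1) hj)
      (((intervalIntegrable_coeFn_sq v).mono_set (uIcc_segment_subset hj)).congr_ae (by
        rw [Filter.EventuallyEq, ae_restrict_iff' measurableSet_uIoc]
        filter_upwards [hae] with x hx hxI using (hx hxI).symm))
    rw [intervalIntegral.integral_congr_ae hae] at hw
    have hlen : π / (((j : ℝ) + 1) / n - j / n) = n * π := by field_simp; ring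
    rw [hlen] at hw
    linarith
  have hpos : 0 < n * π := by positivity
  rw [hT, inv_mul_eq_div, le_div_iff₀ hpos]
  rw [← mul_pow] at hsq
  exact le_of_sq_le_sq hsq (norm_nonneg v)

end Segments

open Polynomial in
lemma exists_derivative_eq {p : ℕ} {q : ℝ[X]} (hq : q.natDegree ≤ p) :
    ∃ Q : ℝ[X], Q.natDegree ≤ p + 1 ∧ derivative Q = q := by
  refine ⟨∑ i ∈ Finset.range (p + 1), monomial (i + 1) (q.coeff i / (i + 1)), ?_, ?_⟩
  · refine natDegree_sum_le_of_forall_le _ _ fun i hi => (natDegree_monomial_le _).trans ?_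
    have := Finset.mem_range.1 hi
    omega
  · conv_rhs => rw [as_sum_range' q (p + 1) (by omega)]
    rw [derivative_sum]
    refine Finset.sum_congr rfl fun i _ => ?_
    have : (i : ℝ) + 1 ≠ 0 := by positivity
    rw [derivative_monomial]
    push_cast
    rw [div_mul_cancel₀ _ this]

/-- Integration raises the degree and the smoothness of a spline by one. -/
lemma volterra_mem_splineSpace {q n : ℕ} [NeZero n] {u : L2}
    (hu : u ∈ splineSpace q ((q : ℤ) - 1) n) :
    volterra u ∈ splineSpace (q + 1) (((q + 1 : ℕ) : ℤ) - 1) n := by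
  obtain ⟨f, ⟨hf, hpoly⟩, huf⟩ := hu
  have hint : ∀ a ∈ Icc (0 : ℝ) 1, ∀ b ∈ Icc (0 : ℝ) 1, a ≤ b →
      ∫ x in a..b, u x = ∫ x in a..b, f x := fun a ha b hb hab => by
    refine intervalIntegral.integral_congr_ae_restrict ?_
    have := ae_restrict_of_ae_restrict_of_subset (μ := volume) (s := Ioo a b)
      (Ioo_subset_Ioo ha.1 hb.2) huf
    rw [uIoc_of_le hab]
    rwa [Measure.restrict_congr_set Ioo_ae_eq_Ioc] at this
  refine ⟨primitive u, ⟨fun r hr => ?_, fun j hj => ?_⟩, coeFn_volterra u⟩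
  · cases r with
    | zero => exact contDiffOn_zero.2 (continuousOn_primitive u)
    | succ s =>
      have hfs := hf s (by push_cast at hr; omega)
      have hd : ∀ x ∈ Icc (0 : ℝ) 1, HasDerivWithinAt (primitive u) (f x) (Icc 0 1) x := by
        intro x hx
        -- extend `f` from `[0, 1]` to a continuous function on the line
        set g : ℝ → ℝ := IccExtend zero_le_one ((Icc (0 : ℝ) 1).domRestrict f) with hg
        have hgc : Continuous g := hfs.continuousOn.domRestrict.Icc_extend'
        have hgf : ∀ y ∈ Icc (0 : ℝ) 1, g y = f y := fun y hy => by
          rw [hg, IccExtend_of_mem _ _ hy, domRestrict_apply]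
        have h := (hgc.integral_hasStrictDerivAt 0 x).hasDerivAt.hasDerivWithinAt (s := Icc 0 1)
        rw [hgf x hx] at h
        refine h.congr_of_mem (fun y hy => ?_) hx
        rw [primitive, hint 0 (by simp) y hy hy.1]
        refine intervalIntegral.integral_congr fun t ht => ?_
        rw [uIcc_of_le hy.1] at ht
        exact (hgf t ⟨ht.1, ht.2.trans hy.2⟩).symm
      have hunique := uniqueDiffOn_Icc (zero_lt_one (α := ℝ))
      push_cast
      rw [contDiffOn_succ_iff_derivWithin hunique]
      refine ⟨fun x hx => (hd x hx).differentiableWithinAt, by simp, ?_⟩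
      exact hfs.congr fun x hx => (hd x hx).derivWithin (hunique x hx)
  · obtain ⟨P, hP, hfP⟩ := hpoly j hj
    obtain ⟨Q, hQ, hQP⟩ := exists_derivative_eq hP
    have ha := segment_subset hj (left_mem_Icc.2 (segment_lt j).le)
    refine ⟨Q + Polynomial.C (primitive u (j / n) - Q.eval (j / n : ℝ)), ?_, fun x hx => ?_⟩
    · rwa [Polynomial.natDegree_add_C]
    · have hx1 := segment_subset hj (Ico_subset_Icc_self hx)
      have h := primitive_sub_primitive u ha hx1
      rw [hint _ ha x hx1 hx.1, intervalIntegral.integral_congr (g := fun t => P.eval t),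
        intervalIntegral.integral_eq_sub_of_hasDerivAt (f := fun t => Q.eval t)] at h
      · simp only [Polynomial.eval_add, Polynomial.eval_C]
        linarith
      · intro t _
        rw [← hQP]
        exact Q.hasDerivAt t
      · exact P.continuous.intervalIntegrable _ _
      · intro t ht
        rw [uIcc_of_le hx.1] at ht
        exact hfP t ⟨ht.1, ht.2.trans_lt hx.2⟩

lemma skewVolterra_mem_splineSpace {q n : ℕ} [NeZero n] {u : L2}
    (hu : u ∈ splineSpace q ((q : ℤ) - 1) n) :
    skewVolterra u ∈ splineSpace (q + 1) (((q + 1 : ℕ) : ℤ) - 1) n := by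
  rw [skewVolterra_apply]
  exact Submodule.sub_mem _ (volterra_mem_splineSpace hu) (smul_oneL2_mem_splineSpace _ _ _ _)

open Real in
lemma norm_skewVolterra_le_of_mem_orthogonal (q : ℕ) {n : ℕ} [NeZero n] {v : L2}
    (hv : v ∈ (splineSpace q ((q : ℤ) - 1) n)ᗮ) : ‖skewVolterra v‖ ≤ (n * π)⁻¹ * ‖v‖ := by
  induction q generalizing v with
  | zero => exact norm_skewVolterra_le_of_mem_orthogonal_piecewiseConstant (by simpa using hv)
  | succ q ih =>
    exact norm_le_of_mem_orthogonal_of_skewAdjoint inner_skewVolterra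
      (fun u hu => skewVolterra_mem_splineSpace hu) (by positivity) (fun v hv => ih hv) hv

/-! ### Weak derivatives -/

/-- Smooth functions with compact support in `(0,1)`. -/
structure IsTestFunction (φ : ℝ → ℝ) : Prop where
  contDiff : ContDiff ℝ ∞ φ
  hasCompactSupport : HasCompactSupport φ
  tsupport_subset : tsupport φ ⊆ Ioo (0 : ℝ) 1

namespace IsTestFunction

variable {φ : ℝ → ℝ}

lemma deriv (hφ : IsTestFunction φ) : IsTestFunction (deriv φ) :=
  ⟨(contDiff_infty_iff_deriv.1 hφ.contDiff).2, hφ.hasCompactSupport.deriv,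
    tsupport_deriv_subset.trans hφ.tsupport_subset⟩

lemma continuous (hφ : IsTestFunction φ) : Continuous φ := hφ.contDiff.continuous

lemma differentiable (hφ : IsTestFunction φ) : Differentiable ℝ φ :=
  (contDiff_infty_iff_deriv.1 hφ.contDiff).1

lemma apply_eq_zero (hφ : IsTestFunction φ) {x : ℝ} (hx : x ∉ Ioo (0 : ℝ) 1) : φ x = 0 :=
  image_eq_zero_of_notMem_tsupport fun h => hx (hφ.tsupport_subset h)

lemma apply_zero (hφ : IsTestFunction φ) : φ 0 = 0 := hφ.apply_eq_zero (by simp)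

lemma apply_one (hφ : IsTestFunction φ) : φ 1 = 0 := hφ.apply_eq_zero (by simp)

lemma sub {ψ : ℝ → ℝ} (hφ : IsTestFunction φ) (hψ : IsTestFunction ψ) :
    IsTestFunction (fun x => φ x - ψ x) :=
  ⟨hφ.contDiff.sub hψ.contDiff, hφ.hasCompactSupport.sub hψ.hasCompactSupport,
    (tsupport_sub φ ψ).trans (union_subset hφ.tsupport_subset hψ.tsupport_subset)⟩

lemma const_mul (hφ : IsTestFunction φ) (c : ℝ) : IsTestFunction (fun x => c * φ x) :=
  ⟨contDiff_const.mul hφ.contDiff, hφ.hasCompactSupport.mul_left,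
    (tsupport_mul_subset_right (f := fun _ => c) (g := φ)).trans hφ.tsupport_subset⟩

/-- A test function of mean zero is the derivative of a test function. -/
lemma exists_deriv_eq (hφ : IsTestFunction φ) (h0 : ∫ x in (0 : ℝ)..1, φ x = 0) :
    ∃ Φ, IsTestFunction Φ ∧ _root_.deriv Φ = φ := by
  set Φ : ℝ → ℝ := fun x => ∫ t in (0 : ℝ)..x, φ t with hΦ
  have hd : _root_.deriv Φ = φ := funext fun x => hφ.continuous.deriv_integral φ 0 x
  have hcd : ContDiff ℝ ∞ Φ := by
    rw [contDiff_infty_iff_deriv, hd]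
    exact ⟨fun x => (hφ.continuous.integral_hasStrictDerivAt 0 x).hasDerivAt.differentiableAt,
      hφ.contDiff⟩
  -- the point `1 / 2` only serves to make the compact set nonempty
  have hK : IsCompact (insert (1 / 2) (tsupport φ)) :=
    IsCompact.insert (show IsCompact (tsupport φ) from hφ.hasCompactSupport) _
  obtain ⟨a, haK, ha⟩ := hK.exists_isLeast (insert_nonempty _ _)
  obtain ⟨b, hbK, hb⟩ := hK.exists_isGreatest (insert_nonempty _ _)
  have hsub : insert (1 / 2) (tsupport φ) ⊆ Ioo (0 : ℝ) 1 :=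
    insert_subset (by norm_num) hφ.tsupport_subset
  have ha01 := hsub haK
  have hb01 := hsub hbK
  have hlt : ∀ x < a, φ x = 0 := fun x hx =>
    image_eq_zero_of_notMem_tsupport fun h => hx.not_ge (ha (mem_insert_of_mem _ h))
  have hgt : ∀ x > b, φ x = 0 := fun x hx =>
    image_eq_zero_of_notMem_tsupport fun h => hx.not_ge (hb (mem_insert_of_mem _ h))
  have hsupp : Function.support Φ ⊆ Icc a b := by
    intro x hx
    by_contra hxI
    refine hx ?_
    rw [mem_Icc, not_and_or, not_le, not_le] at hxI
    rcases hxI with h | h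
    · refine (intervalIntegral.integral_congr (g := fun _ => (0 : ℝ))
        fun t ht => ?_).trans (by simp)
      exact hlt t (ht.2.trans_lt (max_lt ha01.1 h))
    · rw [hΦ]
      dsimp only
      rw [← intervalIntegral.integral_add_adjacent_intervals (b := 1)
        (hφ.continuous.intervalIntegrable _ _) (hφ.continuous.intervalIntegrable _ _), h0, zero_add]
      refine (intervalIntegral.integral_congr (g := fun _ => (0 : ℝ))
        fun t ht => ?_).trans (by simp)
      exact hgt t ((lt_min hb01.2 h).trans_le ht.1)
  have hts : tsupport Φ ⊆ Icc a b := closure_minimal hsupp isClosed_Icc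
  exact ⟨Φ, ⟨hcd, HasCompactSupport.of_support_subset_isCompact isCompact_Icc hsupp,
    hts.trans (Icc_subset_Ioo ha01.1 hb01.2)⟩, hd⟩

end IsTestFunction

lemma exists_isTestFunction_integral_eq_one :
    ∃ η, IsTestFunction η ∧ ∫ x in (0 : ℝ)..1, η x = 1 := by
  let B : ContDiffBump (1 / 2 : ℝ) := ⟨1 / 8, 1 / 4, by norm_num, by norm_num⟩
  have hB : IsTestFunction (B.normed volume) := by
    refine ⟨B.contDiff_normed, B.hasCompactSupport_normed, ?_⟩
    rw [B.tsupport_normed_eq, Real.closedBall_eq_Icc]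
    exact Icc_subset_Ioo (by norm_num [B]) (by norm_num [B])
  refine ⟨_, hB, ?_⟩
  rw [intervalIntegral.integral_of_le zero_le_one, setIntegral_eq_integral_of_forall_compl_eq_zero,
    B.integral_normed]
  exact fun x hx => hB.apply_eq_zero fun h => hx (Ioo_subset_Ioc_self h)

/-- The lemma of du Bois-Reymond. -/
lemma exists_eq_smul_oneL2 {w : L2}
    (hw : ∀ φ, IsTestFunction φ → ∫ x in (0 : ℝ)..1, w x * deriv φ x = 0) :
    ∃ c : ℝ, w = c • oneL2 := by
  obtain ⟨η, hη, hη1⟩ := exists_isTestFunction_integral_eq_one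
  have hmul : ∀ φ, IsTestFunction φ → IntervalIntegrable (fun x => w x * φ x) volume 0 1 :=
    fun φ hφ => (intervalIntegrable_coeFn w).mul_continuousOn hφ.continuous.continuousOn
  set c := ∫ x in (0 : ℝ)..1, w x * η x with hc
  refine ⟨c, Lp.ext ?_⟩
  -- subtracting a multiple of `η` turns any test function into one of mean zero
  have key : ∀ ψ, IsTestFunction ψ → ∫ x in (0 : ℝ)..1, (w x - c) * ψ x = 0 := fun ψ hψ => by
    set m := ∫ x in (0 : ℝ)..1, ψ x with hm
    have hψ0 := hψ.sub (hη.const_mul m)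
    obtain ⟨Φ, hΦ, hΦd⟩ := hψ0.exists_deriv_eq (by
      rw [intervalIntegral.integral_sub (hψ.continuous.intervalIntegrable _ _)
        ((hη.const_mul m).continuous.intervalIntegrable _ _),
        intervalIntegral.integral_const_mul, hη1, ← hm]
      ring)
    have h := hw Φ hΦ
    rw [hΦd] at h
    have e1 : ∀ x, w x * (ψ x - m * η x) = w x * ψ x - m * (w x * η x) := fun x => by ring
    have e2 : ∀ x, (w x - c) * ψ x = w x * ψ x - c * ψ x := fun x => by ring
    simp only [e1, e2] at h ⊢
    rw [intervalIntegral.integral_sub (hmul ψ hψ) ((hmul η hη).const_mul m),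
      intervalIntegral.integral_const_mul, ← hc] at h
    rw [intervalIntegral.integral_sub (hmul ψ hψ)
        ((hψ.const_mul c).continuous.intervalIntegrable _ _),
      intervalIntegral.integral_const_mul, ← hm]
    linarith
  have hloc : LocallyIntegrableOn (fun x => w x - c) (Ioo 0 1) volume := by
    refine IntegrableOn.locallyIntegrableOn ?_
    rw [← intervalIntegrable_iff_integrableOn_Ioo_of_le zero_le_one]
    exact (intervalIntegrable_coeFn w).sub intervalIntegrable_const
  have hae := isOpen_Ioo.ae_eq_zero_of_integral_contDiff_smul_eq_zero hloc
    fun ψ h1 h2 h3 => by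
      have hψ : IsTestFunction ψ := ⟨h1, h2, h3⟩
      rw [← setIntegral_eq_integral_of_forall_compl_eq_zero (s := Ioo (0 : ℝ) 1)
        fun x hx => by rw [hψ.apply_eq_zero hx, zero_smul], integral_unitMeasure]
      simpa only [smul_eq_mul, mul_comm] using key ψ hψ
  filter_upwards [ae_restrict_of_ae hae, ae_restrict_mem measurableSet_Ioo, coeFn_oneL2,
    Lp.coeFn_smul c oneL2] with x hx hxI h1 h2
  rw [h2, Pi.smul_apply, h1, smul_eq_mul, mul_one, ← sub_eq_zero]
  exact hx hxI

lemma integral_volterra_mul_deriv (g : L2) {φ : ℝ → ℝ} (hφ : IsTestFunction φ) :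
    ∫ x in (0 : ℝ)..1, volterra g x * deriv φ x = -∫ x in (0 : ℝ)..1, g x * φ x := by
  have h := (absolutelyContinuousOnInterval_primitive g).integral_mul_deriv_eq_deriv_mul
    ((hφ.contDiff.of_le (by simp)).contDiffOn.absolutelyContinuousOnInterval (a := 0) (b := 1))
  rw [hφ.apply_zero, hφ.apply_one, mul_zero, mul_zero, sub_zero, zero_sub] at h
  rw [intervalIntegral_congr_unitMeasure (g := fun x => primitive g x * deriv φ x), h]
  · congr 1
    refine intervalIntegral.integral_congr_ae ?_
    filter_upwards [ae_deriv_primitive g] with x hx hxI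
    rw [uIoc_of_le zero_le_one] at hxI
    rw [hx (Ioc_subset_Icc_self hxI)]
  · filter_upwards [coeFn_volterra g] with x hx
    rw [hx]

/-- A function with a weak derivative in `L²(0,1)` is, up to a constant, the primitive of it. -/
lemma HasWeakDeriv.exists_eq_volterra_add {s : ℕ} {f u g : L2} (hu : HasWeakDeriv s f u)
    (hg : HasWeakDeriv (s + 1) f g) : ∃ c : ℝ, u = volterra g + c • oneL2 := by
  obtain ⟨c, hc⟩ := exists_eq_smul_oneL2 (w := u - volterra g) fun φ hφ => by
    have h1 := hu _ hφ.deriv.contDiff hφ.deriv.hasCompactSupport hφ.deriv.tsupport_subset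
    have h2 := hg _ hφ.contDiff hφ.hasCompactSupport hφ.tsupport_subset
    rw [← iteratedDeriv_succ', h2, integral_unitMeasure, integral_unitMeasure] at h1
    have hs : (-1 : ℝ) ^ s ≠ 0 := by simp
    rw [pow_succ, mul_assoc, mul_right_inj' hs] at h1
    have hd := hφ.deriv.continuous.continuousOn (s := uIcc (0 : ℝ) 1)
    rw [intervalIntegral_congr_unitMeasure
        (g := fun x => u x * deriv φ x - volterra g x * deriv φ x),
      intervalIntegral.integral_sub ((intervalIntegrable_coeFn u).mul_continuousOn hd)
        ((intervalIntegrable_coeFn (volterra g)).mul_continuousOn hd),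
      integral_volterra_mul_deriv g hφ, ← h1]
    · ring
    · filter_upwards [Lp.coeFn_sub u (volterra g)] with x hx
      rw [hx, Pi.sub_apply, sub_mul]
  exact ⟨c, by rw [← hc]; abel⟩

lemma HasWeakDeriv.sub_skewVolterra_mem_splineSpace {s : ℕ} {f u g : L2} (hu : HasWeakDeriv s f u)
    (hg : HasWeakDeriv (s + 1) f g) (p : ℕ) (k : ℤ) (n : ℕ) :
    u - skewVolterra g ∈ splineSpace p k n := by
  obtain ⟨c, hc⟩ := hu.exists_eq_volterra_add hg
  rw [hc, skewVolterra_apply, add_sub_sub_cancel, ← add_smul]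
  exact smul_oneL2_mem_splineSpace _ _ _ _

/-! ### The upper bound -/

open Real in
/-- The estimate for splines of maximal smoothness: an induction on the degree, in which each
weak derivative of `f` is traded for one degree and a factor `(nπ)⁻¹`. -/
lemma norm_sub_starProjection_maximalSmoothness_le (q : ℕ) {s n : ℕ} [NeZero n] {f u g : L2}
    (hf : MemSobolev (s + q + 1) f) (hu : HasWeakDeriv s f u)
    (hg : HasWeakDeriv (s + q + 1) f g) :
    ‖u - (splineSpace q ((q : ℤ) - 1) n).starProjection u‖ ≤ ((n * π)⁻¹) ^ (q + 1) * ‖g‖ := by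
  induction q generalizing s u with
  | zero =>
    -- no derivative of `g` is available, so `g` is compared with the zero subspace
    have h := norm_sub_starProjection_le_of_skewAdjoint inner_skewVolterra
      (S := (⊥ : Submodule ℝ L2)) (S' := splineSpace 0 (((0 : ℕ) : ℤ) - 1) n)
      (fun u hu => by simp [(Submodule.mem_bot ℝ).1 hu]) (c := (n * π)⁻¹) (by positivity)
      (fun v hv => norm_skewVolterra_le_of_mem_orthogonal 0 hv)
      (hu.sub_skewVolterra_mem_splineSpace hg _ _ _)
    simpa using h
  | succ q ih =>
    obtain ⟨u', hu'⟩ := hf (s + 1) (by omega)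
    have h := norm_sub_starProjection_le_of_skewAdjoint inner_skewVolterra
      (S := splineSpace q ((q : ℤ) - 1) n) (S' := splineSpace (q + 1) (((q + 1 : ℕ) : ℤ) - 1) n)
      (fun u hu => skewVolterra_mem_splineSpace hu) (c := (n * π)⁻¹) (by positivity)
      (fun v hv => norm_skewVolterra_le_of_mem_orthogonal (q + 1) hv)
      (hu.sub_skewVolterra_mem_splineSpace hu' _ _ _)
    refine h.trans ?_
    rw [pow_succ', mul_assoc]
    refine mul_le_mul_of_nonneg_left ?_ (by positivity)
    have e : s + 1 + q + 1 = s + (q + 1) + 1 := by ring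
    exact ih (by rwa [e]) hu' (by rwa [e])

open Real in
lemma norm_sub_splineProj_le {p : ℕ} {k : ℤ} (hkp : k ≤ (p : ℤ) - 1) {n : ℕ} [NeZero n] {f g : L2}
    (hf : MemSobolev (p + 1) f) (hg : HasWeakDeriv (p + 1) f g) :
    ‖f - splineProj p k n f‖ ≤ (((n : ℝ) * π) ^ (p + 1))⁻¹ * ‖g‖ := by
  have hf0 : HasWeakDeriv 0 f f := fun φ _ _ _ => by simp
  have h := norm_sub_starProjection_maximalSmoothness_le p (s := 0) (n := n)
    (by rwa [zero_add]) hf0 (by rwa [zero_add])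
  rw [inv_pow] at h
  refine le_trans ?_ h
  rw [splineProj, Submodule.starProjection_minimal]
  refine ciInf_le ⟨0, forall_mem_range.2 fun _ => norm_nonneg _⟩
    (⟨_, splineSpace_mono_smoothness hkp n (Submodule.starProjection_apply_mem _ f)⟩ :
      splineSpace p k n)

/-! ### The lower bound -/

section Polynomial

open Polynomial

lemma memLp_eval (P : ℝ[X]) : MemLp (fun x => P.eval x) 2 unitMeasure := by
  obtain ⟨C, hC⟩ := (isCompact_Icc (a := (0 : ℝ)) (b := 1)).exists_bound_of_continuousOn
    P.continuous.continuousOn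
  exact MemLp.of_bound P.continuous.aestronglyMeasurable C
    ((ae_restrict_mem measurableSet_Ioo).mono fun x hx => hC x (Ioo_subset_Icc_self hx))

/-- A polynomial as an element of `L²(0,1)`. -/
noncomputable def polynomialL2 (P : ℝ[X]) : L2 := (memLp_eval P).toLp _

lemma coeFn_polynomialL2 (P : ℝ[X]) : polynomialL2 P =ᵐ[unitMeasure] fun x => P.eval x :=
  (memLp_eval P).coeFn_toLp

lemma integral_eval_mul_iteratedDeriv (s : ℕ) (P : ℝ[X]) {φ : ℝ → ℝ} (hφ : IsTestFunction φ) :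
    ∫ x in (0 : ℝ)..1, P.eval x * iteratedDeriv s φ x =
      (-1) ^ s * ∫ x in (0 : ℝ)..1, (derivative^[s] P).eval x * φ x := by
  induction s generalizing φ with
  | zero => simp
  | succ s ih =>
    have h := intervalIntegral.integral_mul_deriv_eq_deriv_mul (a := 0) (b := 1)
      (fun x _ => (derivative^[s] P).hasDerivAt x)
      (fun x _ => (hφ.differentiable x).hasDerivAt)
      ((derivative (derivative^[s] P)).continuous.intervalIntegrable _ _)
      (hφ.deriv.continuous.intervalIntegrable _ _)
    rw [hφ.apply_zero, hφ.apply_one] at h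
    rw [iteratedDeriv_succ', ih hφ.deriv, h, Function.iterate_succ_apply']
    ring

lemma hasWeakDeriv_polynomialL2 (s : ℕ) (P : ℝ[X]) :
    HasWeakDeriv s (polynomialL2 P) (polynomialL2 (derivative^[s] P)) := by
  intro φ h1 h2 h3
  have h := integral_eval_mul_iteratedDeriv s P ⟨h1, h2, h3⟩
  have e1 : ∫ x in (0 : ℝ)..1, polynomialL2 P x * iteratedDeriv s φ x =
      ∫ x in (0 : ℝ)..1, P.eval x * iteratedDeriv s φ x := by
    refine intervalIntegral_congr_unitMeasure ?_
    filter_upwards [coeFn_polynomialL2 P] with x hx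
    rw [hx]
  have e2 : ∫ x in (0 : ℝ)..1, polynomialL2 (derivative^[s] P) x * φ x =
      ∫ x in (0 : ℝ)..1, (derivative^[s] P).eval x * φ x := by
    refine intervalIntegral_congr_unitMeasure ?_
    filter_upwards [coeFn_polynomialL2 (derivative^[s] P)] with x hx
    rw [hx]
  rw [integral_unitMeasure, integral_unitMeasure, e1, e2, h]

lemma norm_polynomialL2_C {c : ℝ} (hc : 0 ≤ c) : ‖polynomialL2 (C c)‖ = c := by
  have h : ‖polynomialL2 (C c)‖ ^ 2 = c ^ 2 := by
    rw [norm_sq_eq_intervalIntegral, intervalIntegral_congr_unitMeasure (g := fun _ => c ^ 2)]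
    · simp
    · filter_upwards [coeFn_polynomialL2 (C c)] with x hx
      rw [hx, eval_C]
  exact (pow_left_inj₀ (norm_nonneg _) hc two_ne_zero).1 h

/-- On each segment, the difference of `x ^ (p + 1)` and a spline of degree at most `p` is a monic
polynomial of degree `p + 1`. -/
lemma le_norm_sub_sq_of_mem_splineSpace {p : ℕ} {k : ℤ} {n : ℕ} [NeZero n] {v : L2}
    (hv : v ∈ splineSpace p k n) :
    (((p + 1).factorial : ℝ) ^ 2 / (2 * (p + 1)).factorial) ^ 2 / (2 * ((p + 1 : ℕ) : ℝ) + 1) *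
      (((n : ℝ) ^ (p + 1))⁻¹) ^ 2 ≤ ‖polynomialL2 (X ^ (p + 1)) - v‖ ^ 2 := by
  obtain ⟨f, ⟨-, hf⟩, hvf⟩ := hv
  have hn : (0 : ℝ) < n := by exact_mod_cast Nat.pos_of_ne_zero (NeZero.ne n)
  set c : ℝ := (((p + 1).factorial : ℝ) ^ 2 / (2 * (p + 1)).factorial) ^ 2 /
    (2 * ((p + 1 : ℕ) : ℝ) + 1) with hc
  set u := polynomialL2 (X ^ (p + 1)) - v with hu
  have hae : u =ᵐ[unitMeasure] fun x => x ^ (p + 1) - f x := by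
    filter_upwards [Lp.coeFn_sub (polynomialL2 (X ^ (p + 1))) v, hvf,
      coeFn_polynomialL2 (X ^ (p + 1))] with x h1 h2 h3
    rw [h1, Pi.sub_apply, h2, h3, eval_pow, eval_X]
  have hseg : ∀ j ∈ Finset.range n, c * (1 / n) ^ (2 * (p + 1) + 1) ≤
      ∫ x in ((j : ℝ) / n)..(((j : ℝ) + 1) / n), u x ^ 2 := fun j hj => by
    rw [Finset.mem_range] at hj
    obtain ⟨q, hq, hfq⟩ := hf j hj
    have hP1 : (X ^ (p + 1) - q).natDegree ≤ p + 1 :=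
      (natDegree_sub_le _ _).trans (max_le (natDegree_X_pow_le _) (by omega))
    have hP2 : (X ^ (p + 1) - q).coeff (p + 1) = 1 := by
      rw [coeff_sub, coeff_X_pow_self, coeff_eq_zero_of_natDegree_lt (by omega), sub_zero]
    have h := le_integral_eval_sq_of_monic (segment_lt (n := n) j) hP1 hP2
    rw [← sub_div, add_sub_cancel_left] at h
    refine h.trans (le_of_eq ?_)
    have hI := segment_subset hj
    rw [Icc_subset_Icc_iff (segment_lt j).le] at hI
    refine intervalIntegral.integral_congr_ae_restrict ?_
    have hr := ae_restrict_of_ae_restrict_of_subset (μ := volume)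
      (Ioo_subset_Ioo hI.1 hI.2) hae
    rw [uIoc_of_le (segment_lt j).le, ← Measure.restrict_congr_set Ioo_ae_eq_Ioc]
    filter_upwards [hr, ae_restrict_mem measurableSet_Ioo] with x hx hxI
    rw [hx, hfq x (Ioo_subset_Ico_self hxI), eval_sub, eval_pow, eval_X]
  have hsum := Finset.sum_le_sum hseg
  rw [sum_integral_segments (intervalIntegrable_coeFn_sq u), ← norm_sq_eq_intervalIntegral,
    Finset.sum_const, Finset.card_range, nsmul_eq_mul] at hsum
  refine le_trans (le_of_eq ?_) hsum
  rw [pow_succ (1 / (n : ℝ)), ← inv_pow, ← pow_mul, one_div, mul_comm 2]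
  field_simp

lemma le_of_mem_admissibleConstants {p : ℕ} {k : ℤ} {n : ℕ} [NeZero n] {C : ℝ}
    (hC : C ∈ admissibleConstants p k n) :
    ((p + 1).factorial : ℝ) / (((2 * p + 2).factorial : ℝ) * √(2 * (p : ℝ) + 3)) *
      ((n : ℝ) ^ (p + 1))⁻¹ ≤ C := by
  have hfac : (0 : ℝ) < (p + 1).factorial := by positivity
  set f := polynomialL2 (X ^ (p + 1)) with hf
  have hD : HasWeakDeriv (p + 1) f (polynomialL2 (Polynomial.C ((p + 1).factorial : ℝ))) := by
    have := hasWeakDeriv_polynomialL2 (p + 1) (X ^ (p + 1))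
    rwa [iterate_derivative_natDegree_eq_C (natDegree_X_pow_le _), coeff_X_pow_self,
      mul_one] at this
  have h := hC f _ (fun s _ => ⟨_, hasWeakDeriv_polynomialL2 s _⟩) hD
  rw [norm_polynomialL2_C hfac.le] at h
  have hlow := le_norm_sub_sq_of_mem_splineSpace (k := k) (n := n) (p := p)
    (v := splineProj p k n f) (Submodule.starProjection_apply_mem _ _)
  have hs : 0 < 2 * (p : ℝ) + 3 := by positivity
  set A : ℝ := ((p + 1).factorial : ℝ) / (((2 * p + 2).factorial : ℝ) * √(2 * (p : ℝ) + 3)) *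
      ((n : ℝ) ^ (p + 1))⁻¹ with hA
  have hsq : (A * (p + 1).factorial) ^ 2 ≤ ‖f - splineProj p k n f‖ ^ 2 := by
    refine le_trans (le_of_eq ?_) hlow
    rw [hA, show 2 * (p + 1) = 2 * p + 2 by ring,
      show 2 * ((p + 1 : ℕ) : ℝ) + 1 = 2 * (p : ℝ) + 3 by push_cast; ring]
    simp only [mul_pow, div_pow, Real.sq_sqrt hs.le]
    field_simp
  have hle := (le_of_sq_le_sq hsq (norm_nonneg _)).trans h
  exact le_of_mul_le_mul_right hle hfac

end Polynomial

lemma isClosed_admissibleConstants (p : ℕ) (k : ℤ) (n : ℕ) [NeZero n] :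
    IsClosed (admissibleConstants p k n) := by
  simp only [admissibleConstants, ofPred_forall]
  exact isClosed_iInter fun f => isClosed_iInter fun g => isClosed_iInter fun _ =>
    isClosed_iInter fun _ => isClosed_le continuous_const (by fun_prop)

end SplineApprox

theorem mainTheorem1 (p : ℕ) (k : ℤ) (hk : -1 ≤ k) (hkp : k ≤ (p : ℤ) - 1)
    (n : ℕ) [NeZero n] :
    IsLeast (SplineApprox.admissibleConstants p k n) (SplineApprox.bestConstant p k n) ∧
    (Nat.factorial (p + 1) : ℝ) / ((Nat.factorial (2 * p + 2) : ℝ) * Real.sqrt (2 * (p : ℝ) + 3)) *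
        ((n : ℝ) ^ (p + 1))⁻¹ ≤ SplineApprox.bestConstant p k n ∧
    SplineApprox.bestConstant p k n ≤ (((n : ℝ) * Real.pi) ^ (p + 1))⁻¹ := by
  have hmem : (((n : ℝ) * Real.pi) ^ (p + 1))⁻¹ ∈ SplineApprox.admissibleConstants p k n :=
    fun f g hf hg => SplineApprox.norm_sub_splineProj_le hkp hf hg
  have hbdd : BddBelow (SplineApprox.admissibleConstants p k n) :=
    ⟨_, fun C hC => SplineApprox.le_of_mem_admissibleConstants hC⟩
  exact ⟨⟨(SplineApprox.isClosed_admissibleConstants p k n).csInf_mem ⟨_, hmem⟩ hbdd,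
      fun C hC => csInf_le hbdd hC⟩,
    le_csInf ⟨_, hmem⟩ fun C hC => SplineApprox.le_of_mem_admissibleConstants hC,
    csInf_le hbdd hmem⟩
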